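/- For an integer $p\ge 1$ let $\Lambda_p$ be the category with objects $[n]$, $n\ge 1$, whose maps $[n]\to[m]$ are the non-decreasing maps $f:\mathbb Z\to\mathbb Z$ with $f(a+n)=f(a)+m$ for all $a$, two maps being identified if they differ by a power of $\sigma^p$, where $\sigma:[n]\to[n]$ is $a\mapsto a+n$; the maps $\sigma$ are central, and they make $E([n])$ a $k[\mathbb Z/p]$-module for every field $k$ and every functor $E$ from $\Lambda_p$ to $k$-vector spaces (a $p$-cyclic object). For $0\le i\le n$ let $m_i:[n+1]\to[n]$ be the map with $m_i(a(n+1)+b)=an+b$ if $0\le b\le i$ and $m_i(a(n+1)+b)=an+b-1$ if $i<b\le n$; on $E([n])$ let $\tau$ be $(-1)^{n-1}$ times the map induced by $a\mapsto a+1$; and put $b_p=\sum_{i=0}^{n}(-1)^i m_i$, $b'_p=\sum_{i=0}^{n-1}(-1)^i m_i$, as maps $E([n+1])\to E([n])$. The standard complex $C_\bullet(E)$ is the complex of $k[\mathbb Z/p]$-modules with $E([n+1])$ in degree $n\ge 0$ and differential $b_p$. The object $E$ is called small if $C_\bullet(E)$ is chain-homotopy equivalent, as a complex of $k[\mathbb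 Z/p]$-modules, to a complex of finite length. The periodic cyclic homology $HP_\bullet(E)$ is the homology of the total complex, formed with products, of the bicomplex with $E([n])$ in row $n\ge 1$ and column $i\in\mathbb Z$, whose horizontal differential from column $i$ to column $i-1$ is $\mathrm{id}-\tau$ for odd $i$ and $\mathrm{id}+\tau+\dots+\tau^{pn-1}$ for even $i$, and whose vertical differential from row $n+1$ to row $n$ is $b_p$ in even columns and $-b'_p$ in odd columns. **Proposition.** Let $k$ be a field of prime characteristic $p$ and let $E$ be a small $p$-cyclic object over $k$ such that $E([n])$ is a free $k[\mathbb Z/p]$-module for every $n\ge 1$. Then $HP_d(E)=0$ for every $d\in\mathbb Z$. -/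

import Mathlib

open CategoryTheory

universe u w

namespace PCyclic

/-! ### The categories `Λ_∞` and `Λ_p` -/

/-- Objects of the category `Λ_∞`: they are numbered by the positive integers, and the object
with number `n` is written `[n]`. -/
@[ext]
structure LambdaInf where
  /-- The positive integer `n` of the object `[n]`. -/
  len : ℕ+

namespace LambdaInf

/-- Morphisms `[n] ⟶ [m]` in `Λ_∞`: non-decreasing maps `f : ℤ → ℤ` with
`f (a + n) = f a + m`. -/
@[ext]
structure Hom (X Y : LambdaInf) where
  /-- The underlying map of integers. -/
  toFun : ℤ → ℤ
  mono : ∀ a b, a ≤ b → toFun a ≤ toFun b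
  map_add : ∀ a, toFun (a + (X.len : ℕ)) = toFun a + (Y.len : ℕ)

instance : Category LambdaInf where
  Hom := Hom
  id _ := ⟨fun a => a, fun _ _ h => h, fun _ => rfl⟩
  comp f g := ⟨fun a => g.toFun (f.toFun a), fun _ _ h => g.mono _ _ (f.mono _ _ h),
    fun a => by rw [f.map_add, g.map_add]⟩

theorem hom_ext {X Y : LambdaInf} {f g : X ⟶ Y} (h : ∀ a, Hom.toFun f a = Hom.toFun g a) :
    f = g :=
  Hom.ext (funext h)

@[simp] theorem id_toFun (X : LambdaInf) (a : ℤ) : Hom.toFun (𝟙 X) a = a := rfl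

@[simp] theorem comp_toFun {X Y Z : LambdaInf} (f : X ⟶ Y) (g : Y ⟶ Z) (a : ℤ) :
    Hom.toFun (f ≫ g) a = Hom.toFun g (Hom.toFun f a) := rfl

theorem map_add_mul {X Y : LambdaInf} (f : X ⟶ Y) (a j : ℤ) :
    Hom.toFun f (a + j * (X.len : ℕ)) = Hom.toFun f a + j * (Y.len : ℕ) := by
  induction j using Int.induction_on with
  | zero => simp
  | succ i ih =>
    rw [show a + ((i : ℤ) + 1) * ((X.len : ℕ) : ℤ) = a + i * (X.len : ℕ) + (X.len : ℕ) by ring,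
      Hom.map_add, ih]
    ring
  | pred i ih =>
    have h := Hom.map_add f (a + (-(i : ℤ) - 1) * ((X.len : ℕ) : ℤ))
    rw [show a + (-(i : ℤ) - 1) * ((X.len : ℕ) : ℤ) + (X.len : ℕ) = a + -(i : ℤ) * (X.len : ℕ)
      by ring, ih] at h
    linarith

/-- The translation `a ↦ a + 1` of `[n]` (no sign). -/
def rot (X : LambdaInf) : X ⟶ X :=
  (⟨fun a => a + 1, fun _ _ h => by omega, fun _ => by omega⟩ : Hom X X)

/-- The endomorphism `σ : a ↦ a + n` of `[n]`. -/
def sigma (X : LambdaInf) : X ⟶ X :=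
  (⟨fun a => a + (X.len : ℕ), fun _ _ h => by omega, fun _ => by omega⟩ : Hom X X)

@[simp] theorem rot_toFun (X : LambdaInf) (a : ℤ) : Hom.toFun (rot X) a = a + 1 := rfl

@[simp] theorem sigma_toFun (X : LambdaInf) (a : ℤ) :
    Hom.toFun (sigma X) a = a + (X.len : ℕ) := rfl

theorem sigma_comm {X Y : LambdaInf} (f : X ⟶ Y) : sigma X ≫ f = f ≫ sigma Y :=
  hom_ext fun a => Hom.map_add f a

/-- The object `[n + 1]`. -/
def ob (n : ℕ) : LambdaInf := ⟨n.succPNat⟩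

@[simp] theorem ob_len (n : ℕ) : (((ob n).len : ℕ) : ℤ) = (n : ℤ) + 1 := by simp [ob]

/-- The map `a * (n + 1) + b ↦ a * n + b` if `b ≤ i` and `a * (n + 1) + b ↦ a * n + (b - 1)` if
`b > i`, where `0 ≤ b ≤ n`. -/
def faceFun (n i : ℕ) (x : ℤ) : ℤ :=
  x / ((n : ℤ) + 1) * n +
    (if x % ((n : ℤ) + 1) ≤ i then x % ((n : ℤ) + 1) else x % ((n : ℤ) + 1) - 1)

theorem faceFun_lt (n i : ℕ) (a b : ℤ) (h0 : 0 ≤ b) (h1 : b ≤ n) :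
    faceFun n i (a * ((n : ℤ) + 1) + b) = a * n + (if b ≤ i then b else b - 1) := by
  have hd : (a * ((n : ℤ) + 1) + b) / ((n : ℤ) + 1) = a := by
    rw [add_comm, Int.add_mul_ediv_right _ _ (by omega), Int.ediv_eq_zero_of_lt h0 (by omega)]
    omega
  have hm : (a * ((n : ℤ) + 1) + b) % ((n : ℤ) + 1) = b := by
    rw [add_comm, Int.add_mul_emod_self_right, Int.emod_eq_of_lt h0 (by omega)]
  simp only [faceFun, hd, hm]

/-- The same formula still holds for `b = n + 1`. -/
theorem faceFun_le (n i : ℕ) (hi : i ≤ n) (a b : ℤ) (h0 : 0 ≤ b) (h1 : b ≤ (n : ℤ) + 1) :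
    faceFun n i (a * ((n : ℤ) + 1) + b) = a * n + (if b ≤ i then b else b - 1) := by
  rcases h1.lt_or_eq with h | h
  · exact faceFun_lt n i a b h0 (by omega)
  · subst h
    have := faceFun_lt n i (a + 1) 0 le_rfl (by omega)
    rw [show (a + 1) * ((n : ℤ) + 1) + 0 = a * ((n : ℤ) + 1) + ((n : ℤ) + 1) by ring] at this
    rw [this, if_pos (by omega), if_neg (by omega)]
    ring

theorem exists_rep (n : ℕ) (x : ℤ) :
    ∃ a b : ℤ, 0 ≤ b ∧ b ≤ n ∧ x = a * ((n : ℤ) + 1) + b :=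
  ⟨x / ((n : ℤ) + 1), x % ((n : ℤ) + 1), Int.emod_nonneg _ (by omega),
    by have := Int.emod_lt_of_pos x (show (0 : ℤ) < (n : ℤ) + 1 by omega); omega,
    by have := Int.mul_ediv_add_emod x ((n : ℤ) + 1); linarith⟩

theorem faceFun_step (n i : ℕ) (x : ℤ) : faceFun n i x ≤ faceFun n i (x + 1) := by
  obtain ⟨a, b, h0, h1, rfl⟩ := exists_rep n x
  rcases h1.lt_or_eq with h | h
  · rw [add_assoc, faceFun_lt n i a b h0 h1, faceFun_lt n i a (b + 1) (by omega) (by omega)]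
    split_ifs <;> omega
  · subst h
    have := faceFun_lt n i (a + 1) 0 le_rfl (by omega)
    rw [show (a + 1) * ((n : ℤ) + 1) + 0 = a * ((n : ℤ) + 1) + (n : ℤ) + 1 by ring] at this
    rw [this, faceFun_lt n i a n h0 le_rfl, add_mul]
    split_ifs <;> omega

theorem faceFun_add (n i : ℕ) (x : ℤ) :
    faceFun n i (x + ((n : ℤ) + 1)) = faceFun n i x + n := by
  obtain ⟨a, b, h0, h1, rfl⟩ := exists_rep n x
  rw [show a * ((n : ℤ) + 1) + b + ((n : ℤ) + 1) = (a + 1) * ((n : ℤ) + 1) + b by ring,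
    faceFun_lt n i _ b h0 h1, faceFun_lt n i _ b h0 h1]
  ring

/-- The maps `m_i : [n + 2] ⟶ [n + 1]`; only those with `0 ≤ i ≤ n + 1` are used. -/
def face (n i : ℕ) : ob (n + 1) ⟶ ob n :=
  (⟨faceFun (n + 1) i, fun _ _ h => monotone_int_of_le_succ (faceFun_step (n + 1) i) h, fun a => by
    have := faceFun_add (n + 1) i a
    push_cast at this ⊢
    simp only [ob_len]
    push_cast
    exact this⟩ : Hom (ob (n + 1)) (ob n))

@[simp] theorem face_toFun (n i : ℕ) (x : ℤ) :
    Hom.toFun (face n i) x = faceFun (n + 1) i x := rfl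

theorem face_face (n i j : ℕ) (hj : j ≤ i) (hi : i ≤ n + 1) :
    face (n + 1) (i + 1) ≫ face n j = face (n + 1) j ≫ face n i := by
  refine hom_ext fun x => ?_
  obtain ⟨a, b, h0, h1, rfl⟩ := exists_rep (n + 2) x
  have key : ∀ r s : ℕ, r ≤ n + 2 → s ≤ n + 1 →
      faceFun (n + 1) s (faceFun (n + 2) r (a * (((n + 2 : ℕ) : ℤ) + 1) + b)) =
        a * ((n + 1 : ℕ) : ℤ) + (if (if b ≤ r then b else b - 1) ≤ s then
          (if b ≤ r then b else b - 1) else (if b ≤ r then b else b - 1) - 1) := by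
    intro r s hr hs
    rw [faceFun_lt _ _ _ _ h0 h1, show ((n + 2 : ℕ) : ℤ) = ((n + 1 : ℕ) : ℤ) + 1 by push_cast; ring]
    refine faceFun_le (n + 1) s hs a _ ?_ ?_
    · split_ifs <;> omega
    · push_cast at h1 ⊢
      split_ifs <;> omega
  simp only [comp_toFun, face_toFun]
  rw [key (i + 1) j (by omega) (by omega), key j i (by omega) (by omega)]
  congr 1
  push_cast
  split_ifs <;> omega

theorem rot_face_succ (n i : ℕ) (hi : i ≤ n) :
    rot _ ≫ face n (i + 1) = face n i ≫ rot _ := by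
  refine hom_ext fun x => ?_
  obtain ⟨a, b, h0, h1, rfl⟩ := exists_rep (n + 1) x
  simp only [comp_toFun, face_toFun, rot_toFun]
  rw [add_assoc, faceFun_le _ _ (by omega) a (b + 1) (by omega) (by omega), faceFun_lt _ _ _ _ h0 h1]
  push_cast
  split_ifs <;> omega

theorem rot_face_zero (n : ℕ) : rot _ ≫ face n 0 = face n (n + 1) := by
  refine hom_ext fun x => ?_
  obtain ⟨a, b, h0, h1, rfl⟩ := exists_rep (n + 1) x
  simp only [comp_toFun, face_toFun, rot_toFun]
  rw [add_assoc, faceFun_le _ _ (by omega) a (b + 1) (by omega) (by omega), faceFun_lt _ _ _ _ h0 h1]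
  push_cast at h1 ⊢
  split_ifs <;> omega

/-- The relation on `Λ_∞([n], [m])` defining `Λ_p([n], [m]) = Λ_∞([n], [m]) / σ ^ p`: two maps
are identified when they differ by a power of `σ ^ p`. -/
def shiftRel (p : ℕ) : HomRel LambdaInf := fun _ Y f g =>
  ∃ j : ℤ, ∀ a, Hom.toFun g a = Hom.toFun f a + j * p * (Y.len : ℕ)

instance (p : ℕ) : Congruence (shiftRel p) where
  comp_left := by
    rintro X Y Z f g g' ⟨j, h⟩
    exact ⟨j, fun a => h _⟩
  comp_right := by
    rintro X Y Z f f' g ⟨j, h⟩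
    refine ⟨j, fun a => ?_⟩
    rw [comp_toFun, comp_toFun, h, map_add_mul]
  equivalence :=
    { refl := fun f => ⟨0, fun a => by simp⟩
      symm := by
        rintro f g ⟨j, h⟩
        exact ⟨-j, fun a => by rw [h]; ring⟩
      trans := by
        rintro f g e ⟨j, h⟩ ⟨l, h'⟩
        exact ⟨j + l, fun a => by rw [h', h]; ring⟩ }

end LambdaInf

/-- The category `Λ_p`: the same objects as `Λ_∞`, and `Λ_p([n], [m]) = Λ_∞([n], [m]) / σ ^ p`. -/
abbrev Lambda (p : ℕ) := CategoryTheory.Quotient (LambdaInf.shiftRel p)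

/-- The projection `Λ_∞ ⥤ Λ_p`. -/
abbrev proj (p : ℕ) : LambdaInf ⥤ Lambda p := CategoryTheory.Quotient.functor _

/-- The object `[n + 1]` of `Λ_p`. -/
abbrev ob (p n : ℕ) : Lambda p := (proj p).obj (LambdaInf.ob n)

/-- The category `Fun(Λ_p, k)` of `p`-cyclic objects over `k`. -/
abbrev PCyclicObject (p : ℕ) (k : Type u) [Field k] := Lambda p ⥤ ModuleCat.{w} k

/-! ### Some sums of linear maps -/

section Algebra

theorem sum_cancel {M : Type*} [AddCommGroup M] (F : ℕ → ℕ → M) (N : ℕ)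
    (hF : ∀ i j, j ≤ i → i < N → F (i + 1) j = -F j i) :
    ∑ i ∈ Finset.range (N + 1), ∑ j ∈ Finset.range N, F i j = 0 := by
  induction N with
  | zero => simp
  | succ N ih =>
    rw [Finset.sum_range_succ]
    have h1 : ∑ j ∈ Finset.range (N + 1), F (N + 1) j = -∑ j ∈ Finset.range (N + 1), F j N := by
      rw [← Finset.sum_neg_distrib]
      refine Finset.sum_congr rfl fun j hj => hF N j ?_ (by omega)
      have := Finset.mem_range.1 hj
      omega
    rw [h1]
    have h2 := ih fun i j h h' => hF i j h (by omega)
    rw [Finset.sum_range_succ] at h2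
    simp only [Finset.sum_range_succ _ N, Finset.sum_add_distrib]
    rw [add_add_add_comm, h2, zero_add, add_neg_cancel]

variable {k : Type*} [Field k] {V W : Type*} [AddCommGroup V] [AddCommGroup W]
  [Module k V] [Module k W]

theorem lin_sum_comp {U ι : Type*} [AddCommGroup U] [Module k U] (s : Finset ι)
    (f : ι → V →ₗ[k] W) (g : U →ₗ[k] V) : (∑ i ∈ s, f i) ∘ₗ g = ∑ i ∈ s, f i ∘ₗ g := by
  ext x
  simp

theorem lin_comp_sum {U ι : Type*} [AddCommGroup U] [Module k U] (s : Finset ι)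
    (g : V →ₗ[k] W) (f : ι → U →ₗ[k] V) : g ∘ₗ (∑ i ∈ s, f i) = ∑ i ∈ s, g ∘ₗ f i := by
  ext x
  simp

theorem sum_one_sub (n : ℕ) (a : ℕ → V →ₗ[k] W) (s : V →ₗ[k] V) (t : W →ₗ[k] W)
    (h : ∀ i < n, a (i + 1) ∘ₗ s = t ∘ₗ a i) (h0 : a 0 ∘ₗ s = a n) :
    (∑ i ∈ Finset.range (n + 1), a i) ∘ₗ (1 - s) =
      (1 - t) ∘ₗ ∑ i ∈ Finset.range n, a i := by
  have e : (∑ i ∈ Finset.range (n + 1), a i) ∘ₗ s =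
      t ∘ₗ (∑ i ∈ Finset.range n, a i) + a n := by
    rw [Finset.sum_range_succ', LinearMap.add_comp, h0, lin_sum_comp, lin_comp_sum]
    congr 1
    exact Finset.sum_congr rfl fun i hi => h i (Finset.mem_range.1 hi)
  rw [LinearMap.comp_sub, LinearMap.sub_comp, e, Finset.sum_range_succ, Module.End.one_eq_id,
    Module.End.one_eq_id, LinearMap.comp_id, LinearMap.id_comp]
  abel

theorem sum_comp_pow (n : ℕ) (a : ℕ → V →ₗ[k] W) (s : V →ₗ[k] V) (t : W →ₗ[k] W)
    (h : ∀ i < n, a (i + 1) ∘ₗ s = t ∘ₗ a i) (h0 : a 0 ∘ₗ s = a n) (j : ℕ) (hj : j < n) :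
    (∑ i ∈ Finset.range n, a i) ∘ₗ (s ^ (j + 1)) =
      (t ^ (j + 1)) ∘ₗ (∑ i ∈ Finset.range (n - (j + 1)), a i) +
        (t ^ j) ∘ₗ (∑ i ∈ Finset.Ico (n - j) (n + 1), a i) := by
  induction j with
  | zero =>
    obtain ⟨m, rfl⟩ : ∃ m, n = m + 1 := ⟨n - 1, by omega⟩
    have e1 : Finset.Ico (m + 1) (m + 1 + 1) = {m + 1} := by ext; simp
    simp only [zero_add, pow_one, pow_zero, Nat.sub_zero, Nat.add_sub_cancel, e1,
      Finset.sum_singleton, Module.End.one_eq_id, LinearMap.id_comp]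
    rw [Finset.sum_range_succ', LinearMap.add_comp, h0, lin_sum_comp, lin_comp_sum]
    congr 1
    exact Finset.sum_congr rfl fun i hi => h i (by have := Finset.mem_range.1 hi; omega)
  | succ j ih =>
    obtain ⟨m, rfl⟩ : ∃ m, n = m + 1 + (j + 1) := ⟨n - (j + 1) - 1, by omega⟩
    rw [pow_succ s (j + 1), Module.End.mul_eq_comp, ← LinearMap.comp_assoc, ih (by omega)]
    have e1 : m + 1 + (j + 1) - (j + 1) = m + 1 := by omega
    have e2 : m + 1 + (j + 1) - (j + 1 + 1) = m := by omega
    have e3 : m + 1 + (j + 1) - j = m + 1 + 1 := by omega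
    rw [e1, e2, e3, LinearMap.add_comp, LinearMap.comp_assoc, LinearMap.comp_assoc,
      Finset.sum_range_succ' _ m, LinearMap.add_comp, h0, lin_sum_comp]
    have f1 : ∑ i ∈ Finset.range m, a (i + 1) ∘ₗ s = t ∘ₗ ∑ i ∈ Finset.range m, a i := by
      rw [lin_comp_sum]
      exact Finset.sum_congr rfl fun i hi => h i (by have := Finset.mem_range.1 hi; omega)
    have f2 : (∑ i ∈ Finset.Ico (m + 1 + 1) (m + 1 + (j + 1) + 1), a i) ∘ₗ s =
        t ∘ₗ ∑ i ∈ Finset.Ico (m + 1) (m + 1 + (j + 1)), a i := by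
      rw [lin_comp_sum, lin_sum_comp, ← Finset.sum_Ico_add']
      exact Finset.sum_congr rfl fun i hi => h i (by have := Finset.mem_Ico.1 hi; omega)
    rw [f1, f2, Finset.sum_Ico_succ_top (by omega : m + 1 ≤ m + 1 + (j + 1)), LinearMap.comp_add,
      LinearMap.comp_add, pow_succ t (j + 1), Module.End.mul_eq_comp, LinearMap.comp_assoc]
    conv_rhs => rw [pow_succ t j, Module.End.mul_eq_comp, LinearMap.comp_assoc]
    rw [pow_succ t j, Module.End.mul_eq_comp, LinearMap.comp_assoc, LinearMap.comp_assoc]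
    abel

theorem sum_comp_geom (n : ℕ) (a : ℕ → V →ₗ[k] W) (s : V →ₗ[k] V) (t : W →ₗ[k] W)
    (h : ∀ i < n, a (i + 1) ∘ₗ s = t ∘ₗ a i) (h0 : a 0 ∘ₗ s = a n) :
    (∑ i ∈ Finset.range n, a i) ∘ₗ (∑ j ∈ Finset.range (n + 1), s ^ j) =
      (∑ j ∈ Finset.range n, t ^ j) ∘ₗ (∑ i ∈ Finset.range (n + 1), a i) := by
  rw [Finset.sum_range_succ', LinearMap.comp_add, lin_comp_sum,
    Finset.sum_congr rfl fun j hj => sum_comp_pow n a s t h h0 j (Finset.mem_range.1 hj),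
    Finset.sum_add_distrib, add_right_comm]
  have e : ∑ j ∈ Finset.range n, (t ^ (j + 1)) ∘ₗ (∑ i ∈ Finset.range (n - (j + 1)), a i) +
      (∑ i ∈ Finset.range n, a i) ∘ₗ (s ^ 0) =
      ∑ j ∈ Finset.range n, (t ^ j) ∘ₗ (∑ i ∈ Finset.range (n - j), a i) := by
    have := Finset.sum_range_succ' (fun j => (t ^ j) ∘ₗ (∑ i ∈ Finset.range (n - j), a i)) n
    rw [Finset.sum_range_succ] at this
    simpa [Module.End.one_eq_id] using this.symm
  rw [e, ← Finset.sum_add_distrib, lin_sum_comp]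
  refine Finset.sum_congr rfl fun j _ => ?_
  rw [← LinearMap.comp_add, Finset.sum_range_add_sum_Ico _ (by omega)]

theorem geom_mul {R : Type*} [Ring R] (x : R) (n p : ℕ) :
    ∑ j ∈ Finset.range (p * n), x ^ j =
      (∑ j ∈ Finset.range n, x ^ j) * ∑ j ∈ Finset.range p, (x ^ n) ^ j := by
  induction p with
  | zero => simp
  | succ p ih =>
    rw [Nat.succ_mul, Finset.sum_range_add, ih, Finset.sum_range_succ _ p, mul_add]
    congr 1
    rw [← pow_mul, Finset.sum_mul]
    exact Finset.sum_congr rfl fun j _ => by rw [← pow_add, add_comm, mul_comm n p]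

end Algebra

/-! ### The operators on a `p`-cyclic object -/

noncomputable section

variable {p : ℕ} {k : Type u} [Field k] (E : PCyclicObject.{u, w} p k)

/-- The action of a map of `Λ_∞` on `E`. -/
def act {X Y : LambdaInf} (f : X ⟶ Y) : E.obj ((proj p).obj X) →ₗ[k] E.obj ((proj p).obj Y) :=
  (E.map ((proj p).map f)).hom

theorem act_comp {X Y Z : LambdaInf} (f : X ⟶ Y) (g : Y ⟶ Z) :
    act E (f ≫ g) = act E g ∘ₗ act E f := by simp [act]

theorem act_id (X : LambdaInf) : act E (𝟙 X) = 1 := by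
  simp [act, Module.End.one_eq_id]

/-- The action of `σ` on `E([n])`. -/
def sigma (X : LambdaInf) : Module.End k (E.obj ((proj p).obj X)) := act E (LambdaInf.sigma X)

theorem sigma_comm {X Y : LambdaInf} (f : X ⟶ Y) :
    act E f ∘ₗ sigma E X = sigma E Y ∘ₗ act E f := by
  rw [sigma, sigma, ← act_comp, ← act_comp, LambdaInf.sigma_comm]

theorem sigma_pow_comm {X Y : LambdaInf} (f : X ⟶ Y) (m : ℕ) :
    act E f ∘ₗ (sigma E X ^ m) = (sigma E Y ^ m) ∘ₗ act E f := by
  induction m with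
  | zero => rfl
  | succ m ih =>
    rw [pow_succ, pow_succ, Module.End.mul_eq_comp, Module.End.mul_eq_comp, ← LinearMap.comp_assoc,
      ih, LinearMap.comp_assoc, sigma_comm, LinearMap.comp_assoc]

theorem exists_pow {X : LambdaInf} (f : X ⟶ X) (c : ℤ)
    (hf : ∀ a, LambdaInf.Hom.toFun f a = a + c) (m : ℕ) :
    ∃ g : X ⟶ X, (∀ a, LambdaInf.Hom.toFun g a = a + m * c) ∧ act E f ^ m = act E g := by
  induction m with
  | zero => exact ⟨𝟙 X, fun a => by simp, by rw [act_id, pow_zero]⟩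
  | succ m ih =>
    obtain ⟨g, hg, hE⟩ := ih
    refine ⟨f ≫ g, fun a => ?_, ?_⟩
    · rw [LambdaInf.comp_toFun, hg, hf]
      push_cast
      ring
    · rw [act_comp, pow_succ, hE, Module.End.mul_eq_comp]

theorem sigma_pow (X : LambdaInf) : sigma E X ^ p = 1 := by
  obtain ⟨g, hg, hE⟩ := exists_pow E (LambdaInf.sigma X) _ (fun _ => rfl) p
  rw [sigma, hE, ← act_id, act, act]
  congr 2
  refine CategoryTheory.Quotient.sound _ ⟨-1, fun a => ?_⟩
  rw [hg, LambdaInf.id_toFun]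
  ring

theorem rot_pow (X : LambdaInf) : act E (LambdaInf.rot X) ^ (X.len : ℕ) = sigma E X := by
  obtain ⟨g, hg, hE⟩ := exists_pow E (LambdaInf.rot X) 1 (fun _ => rfl) X.len
  rw [hE, sigma]
  congr 1
  refine LambdaInf.hom_ext fun a => ?_
  rw [hg, LambdaInf.sigma_toFun, mul_one]

/-- The action of `ℤ/p` on `E([n])`: the residue of `j` acts by `σ ^ j`. -/
def rho [NeZero p] (X : LambdaInf) :
    Representation k (Multiplicative (ZMod p)) (E.obj ((proj p).obj X)) where
  toFun g := sigma E X ^ (Multiplicative.toAdd g).val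
  map_one' := by simp
  map_mul' g h := by
    rw [toAdd_mul, ZMod.val_add, ← pow_eq_pow_mod _ (sigma_pow E X), pow_add]

/-- The operator `τ` on `E([n + 1])`: the translation `a ↦ a + 1` twisted by the sign
`(-1) ^ n`. -/
def tau (n : ℕ) : Module.End k (E.obj (ob p n)) :=
  ((-1 : ℤ) ^ n) • act E (LambdaInf.rot (LambdaInf.ob n))

/-- The operator `(-1) ^ i m_i : E([n + 2]) → E([n + 1])`. -/
def signedFace (n i : ℕ) : E.obj (ob p (n + 1)) →ₗ[k] E.obj (ob p n) :=
  ((-1 : ℤ) ^ i) • act E (LambdaInf.face n i)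

/-- The Hochschild differential `b_p = ∑_{0 ≤ i ≤ n + 1} (-1) ^ i m_i : E([n + 2]) → E([n + 1])`. -/
def b (n : ℕ) : E.obj (ob p (n + 1)) →ₗ[k] E.obj (ob p n) :=
  ∑ i ∈ Finset.range (n + 2), signedFace E n i

/-- The differential `b'_p = ∑_{0 ≤ i ≤ n} (-1) ^ i m_i : E([n + 2]) → E([n + 1])`. -/
def b' (n : ℕ) : E.obj (ob p (n + 1)) →ₗ[k] E.obj (ob p n) :=
  ∑ i ∈ Finset.range (n + 1), signedFace E n i

/-- The norm operator `1 + τ + ⋯ + τ ^ (p * (n + 1) - 1)` on `E([n + 1])`. -/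
def normTau (n : ℕ) : Module.End k (E.obj (ob p n)) :=
  ∑ j ∈ Finset.range (p * (n + 1)), tau E n ^ j

theorem tau_pow (n : ℕ) : tau E n ^ (n + 1) = sigma E (LambdaInf.ob n) := by
  rw [tau, smul_pow, ← pow_mul, (Nat.even_mul_succ_self n).neg_one_pow, one_smul, ← rot_pow]
  rfl

theorem tau_pow_mul (n : ℕ) : tau E n ^ (p * (n + 1)) = 1 := by
  rw [mul_comm, pow_mul, tau_pow, sigma_pow]

theorem signedFace_tau_succ (n i : ℕ) (hi : i < n + 1) :
    signedFace E n (i + 1) ∘ₗ tau E (n + 1) = tau E n ∘ₗ signedFace E n i := by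
  simp only [signedFace, tau, LinearMap.smul_comp, LinearMap.comp_smul, smul_smul]
  rw [← act_comp, ← act_comp, LambdaInf.rot_face_succ n i (by omega)]
  congr 1
  ring

theorem signedFace_tau_zero (n : ℕ) :
    signedFace E n 0 ∘ₗ tau E (n + 1) = signedFace E n (n + 1) := by
  simp only [signedFace, tau, LinearMap.smul_comp, LinearMap.comp_smul, smul_smul]
  rw [← act_comp, LambdaInf.rot_face_zero]
  congr 1
  ring

theorem signedFace_comp (n i j : ℕ) (hj : j ≤ i) (hi : i ≤ n + 1) :
    signedFace E n j ∘ₗ signedFace E (n + 1) (i + 1) =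
      -(signedFace E n i ∘ₗ signedFace E (n + 1) j) := by
  simp only [signedFace, LinearMap.smul_comp, LinearMap.comp_smul, smul_smul]
  rw [← act_comp, ← act_comp, LambdaInf.face_face n i j hj hi, ← neg_smul]
  congr 1
  ring

theorem b_b (n : ℕ) : b E n ∘ₗ b E (n + 1) = 0 := by
  have := sum_cancel (fun i j => signedFace E n j ∘ₗ signedFace E (n + 1) i) (n + 2)
    fun i j hj hi => signedFace_comp E n i j hj (by omega)
  rw [b, b, lin_comp_sum, ← this]
  exact Finset.sum_congr rfl fun i _ => lin_sum_comp _ _ _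

theorem b'_b' (n : ℕ) : b' E n ∘ₗ b' E (n + 1) = 0 := by
  have := sum_cancel (fun i j => signedFace E n j ∘ₗ signedFace E (n + 1) i) (n + 1)
    fun i j hj hi => signedFace_comp E n i j hj (by omega)
  rw [b', b', lin_comp_sum, ← this]
  exact Finset.sum_congr rfl fun i _ => lin_sum_comp _ _ _

theorem b_one_sub_tau (n : ℕ) :
    b E n ∘ₗ (1 - tau E (n + 1)) = (1 - tau E n) ∘ₗ b' E n :=
  sum_one_sub (n + 1) _ _ _ (fun i hi => signedFace_tau_succ E n i hi) (signedFace_tau_zero E n)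

theorem sigma_signedFace (n i m : ℕ) :
    signedFace E n i ∘ₗ (sigma E _ ^ m) = (sigma E _ ^ m) ∘ₗ signedFace E n i := by
  rw [signedFace, LinearMap.smul_comp, LinearMap.comp_smul, sigma_pow_comm]

theorem sigma_b (n m : ℕ) : b E n ∘ₗ (sigma E _ ^ m) = (sigma E _ ^ m) ∘ₗ b E n := by
  rw [b, lin_sum_comp, lin_comp_sum]
  exact Finset.sum_congr rfl fun i _ => sigma_signedFace E n i m

theorem b'_normTau (n : ℕ) : b' E n ∘ₗ normTau E (n + 1) = normTau E n ∘ₗ b E n := by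
  have h := sum_comp_geom (n + 1) _ _ _ (fun i hi => signedFace_tau_succ E n i hi)
    (signedFace_tau_zero E n)
  rw [normTau, normTau, geom_mul, geom_mul, tau_pow, tau_pow, Module.End.mul_eq_comp,
    Module.End.mul_eq_comp]
  have e : b' E n ∘ₗ (∑ j ∈ Finset.range (n + 1 + 1), tau E (n + 1) ^ j) =
      (∑ j ∈ Finset.range (n + 1), tau E n ^ j) ∘ₗ b E n := h
  have e' : b E n ∘ₗ (∑ j ∈ Finset.range p, sigma E (LambdaInf.ob (n + 1)) ^ j) =
      (∑ j ∈ Finset.range p, sigma E (LambdaInf.ob n) ^ j) ∘ₗ b E n := by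
    rw [lin_sum_comp, lin_comp_sum]
    exact Finset.sum_congr rfl fun m _ => sigma_b E n m
  rw [← LinearMap.comp_assoc, e, LinearMap.comp_assoc, e', LinearMap.comp_assoc]

theorem one_sub_tau_normTau (n : ℕ) : (1 - tau E n) ∘ₗ normTau E n = 0 := by
  have := mul_neg_geom_sum (tau E n) (p * (n + 1))
  rwa [tau_pow_mul, sub_self] at this

theorem normTau_one_sub_tau (n : ℕ) : normTau E n ∘ₗ (1 - tau E n) = 0 := by
  have := geom_sum_mul_neg (tau E n) (p * (n + 1))
  rwa [tau_pow_mul, sub_self] at this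

/-! ### The standard complex and smallness -/

/-- The differential `b_p` as a map of representations of `ℤ/p`. -/
def bRep [NeZero p] (n : ℕ) :
    Rep.of (rho E (LambdaInf.ob (n + 1))) ⟶ Rep.of (rho E (LambdaInf.ob n)) :=
  Rep.ofHom ⟨b E n, fun _ => sigma_b E n _⟩

/-- The standard complex `C_•(E)`, as a complex of `k[ℤ/p]`-modules: `E([n + 1])` in degree `n`,
with the differential `b_p`. -/
def standardComplex [NeZero p] : ChainComplex (Rep.{w} k (Multiplicative (ZMod p))) ℕ :=
  ChainComplex.of (fun n => Rep.of (rho E (LambdaInf.ob n))) (bRep E) fun n => by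
    apply Rep.hom_ext
    exact Representation.IntertwiningMap.ext (b_b E n)

/-- A complex is effectively finite if it is chain-homotopy equivalent to a complex of finite
length. -/
def IsEffectivelyFinite {C : Type*} [Category C] [Preadditive C] (W : ChainComplex C ℕ) : Prop :=
  ∃ (D : ChainComplex C ℕ) (N : ℕ), (∀ n, N < n → Limits.IsZero (D.X n)) ∧
    Nonempty (HomotopyEquiv W D)

/-- A `p`-cyclic object is small if its standard complex, as a complex of `k[ℤ/p]`-modules, is
effectively finite. -/
def IsSmall [NeZero p] : Prop := IsEffectivelyFinite (standardComplex E)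

/-- Every `E([n])` is a free `k[ℤ/p]`-module. -/
def IsTermwiseFree [NeZero p] : Prop :=
  ∀ X : LambdaInf, Module.Free (MonoidAlgebra k (Multiplicative (ZMod p))) (rho E X).asModule

/-! ### Periodic cyclic homology

The periodic bicomplex has columns numbered by `i : ℤ`, rows numbered by `n : ℕ`, and `E([n + 1])`
in column `i` and row `n`. The horizontal differential from column `i` to column `i - 1` is
`1 - τ` for odd `i` and the norm of `τ` for even `i`. The vertical differential from row `n + 1` to
row `n` is `b_p` in even columns and `-b'_p` in odd columns. -/

/-- The horizontal differential from column `i` to column `i - 1` in row `n`. -/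
def horiz (i : ℤ) (n : ℕ) : Module.End k (E.obj (ob p n)) :=
  if Even i then normTau E n else 1 - tau E n

/-- The vertical differential from row `n + 1` to row `n` in column `i`. -/
def vert (i : ℤ) (n : ℕ) : E.obj (ob p (n + 1)) →ₗ[k] E.obj (ob p n) :=
  if Even i then b E n else -b' E n

theorem horiz_horiz (i : ℤ) (n : ℕ) : horiz E (i - 1) n ∘ₗ horiz E i n = 0 := by
  by_cases h : Even i
  · simp only [horiz, h, Int.even_sub_one, not_true_eq_false, if_true, if_false,
      one_sub_tau_normTau]
  · simp only [horiz, h, Int.even_sub_one, not_false_eq_true, if_true, if_false,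
      normTau_one_sub_tau]

theorem vert_vert (i : ℤ) (n : ℕ) : vert E i n ∘ₗ vert E i (n + 1) = 0 := by
  by_cases h : Even i
  · simp only [vert, h, if_true, b_b]
  · simp only [vert, h, if_false, LinearMap.neg_comp, LinearMap.comp_neg, b'_b', neg_zero]

theorem horiz_vert (i : ℤ) (n : ℕ) :
    horiz E i n ∘ₗ vert E i n + vert E (i - 1) n ∘ₗ horiz E i (n + 1) = 0 := by
  by_cases h : Even i
  · simp only [horiz, vert, h, Int.even_sub_one, not_true_eq_false, if_true, if_false,
      LinearMap.neg_comp, b'_normTau, add_neg_cancel]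
  · simp only [horiz, vert, h, Int.even_sub_one, not_false_eq_true, if_true, if_false,
      LinearMap.comp_neg, b_one_sub_tau, neg_add_cancel]

/-- The differential of the product total complex, from degree `d` to degree `d - 1`. The entry of
degree `d` in row `n` lies in column `d - n`. -/
def totalD (d : ℤ) : (∀ n : ℕ, E.obj (ob p n)) →ₗ[k] (∀ n : ℕ, E.obj (ob p n)) :=
  LinearMap.pi fun n =>
    horiz E (d - n) n ∘ₗ LinearMap.proj n + vert E (d - 1 - n) n ∘ₗ LinearMap.proj (n + 1)

theorem totalD_totalD (d : ℤ) : totalD E (d - 1) ∘ₗ totalD E d = 0 := by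
  refine LinearMap.ext fun x => funext fun n => ?_
  have h1 := LinearMap.congr_fun (horiz_horiz E (d - n) n) (x n)
  have h2 := LinearMap.congr_fun (vert_vert E (d - 1 - 1 - n) n) (x (n + 1 + 1))
  have h3 := LinearMap.congr_fun (horiz_vert E (d - 1 - n) n) (x (n + 1))
  have e1 : d - (n : ℤ) - 1 = d - 1 - n := by ring
  have e2 : d - 1 - ((n + 1 : ℕ) : ℤ) = d - 1 - 1 - n := by push_cast; ring
  have e3 : d - 1 - (n : ℤ) - 1 = d - 1 - 1 - n := by ring
  have e4 : d - ((n + 1 : ℕ) : ℤ) = d - 1 - n := by push_cast; ring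
  rw [e1] at h1
  rw [e3] at h3
  simp only [LinearMap.comp_apply, LinearMap.add_apply, LinearMap.zero_apply] at h1 h2 h3
  simp only [totalD, LinearMap.comp_apply, LinearMap.pi_apply, LinearMap.add_apply,
    LinearMap.proj_apply, LinearMap.zero_apply, Pi.zero_apply, map_add, e2, e4]
  rw [h1, h2, zero_add, add_zero]
  exact h3

/-- The complex computing periodic cyclic homology: the total complex of the periodic bicomplex,
formed with products. -/
def periodicComplex : ChainComplex (ModuleCat.{w} k) ℤ where
  X _ := ModuleCat.of k (∀ n : ℕ, E.obj (ob p n))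
  d i j := if j + 1 = i then ModuleCat.ofHom (totalD E i) else 0
  shape i j h := if_neg h
  d_comp_d' i j l hij hjl := by
    obtain rfl : j + 1 = i := hij
    obtain rfl : l + 1 = j := hjl
    have := totalD_totalD E (l + 1 + 1)
    rw [add_sub_cancel_right] at this
    rw [if_pos rfl, if_pos rfl, ← ModuleCat.ofHom_comp, this]
    rfl

/-- The periodic cyclic homology `HP_d(E)`. -/
def HP (d : ℤ) : ModuleCat.{w} k := (periodicComplex E).homology d

end

end PCyclic

/-!
Periodic cyclic homology is a Tate cohomology of the circle, and in characteristic `p` it is a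
retract, up to homotopy, of the Tate cohomology of the subgroup `ℤ/p`: the obstruction to this is
multiplication by `p`. Smallness and freeness are used to kill the latter.

In concrete terms, compare the periodic bicomplex with the Tate bicomplex of `ℤ/p`, which has the
standard complex in every column and the horizontal differentials `1 - σ` and
`N = 1 + σ + ⋯ + σ ^ (p - 1)`. As `1 - σ = (1 - τ) g` with `g = 1 + τ + ⋯ + τ ^ n`, the identity in
even columns and `g` in odd columns map the Tate bicomplex to the periodic one. The extra degeneracy
`s` satisfies `b' s + s b' = 1`; hence `(1 - τ) s g` is a homotopy from `0` to `1 - σ` on the standard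
complex, and `K = (1 - τ) s g (1 - σ) ^ (p - 2)` one from `0` to `N = (1 - σ) ^ (p - 1)`. With `s` and
`K` one writes down a homotopy section of the comparison map, so that the periodic bicomplex is exact
if the Tate bicomplex is (`periodic_exact_of_tate_exact`).

The rows of the Tate bicomplex are exact because each `E([n])` is free over `k[ℤ/p]`
(`exists_norm_eq_of_free`, `exists_sub_eq_of_free`). Since its total complex is formed with products,
this only shows that cycles with finitely many nonzero rows are boundaries (`tate_exact_of_finite`).
Smallness provides an equivariant contraction of the standard complex in high degrees
(`IsSmall.exists_contraction`), and this moves every cycle to one with finitely many nonzero rows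
(`tate_exact`).
-/

namespace PCyclic

/-! ### Comparison of the periodic bicomplex with a Tate bicomplex -/

section Comparison

variable {k M : Type*} [Field k] [AddCommGroup M] [Module k M]

/-- The operators are to be read as `t = 1 - τ`, `g = 1 + τ + ⋯ + τ ^ n` on `E([n + 1])`,
`a = 1 - σ`, `ν = (1 - σ) ^ (p - 2)` and `s` the extra degeneracy, so that `ν a` is the norm of `σ`
and `g ν a` the norm of `τ`. The pair `(z, w)` collects the entries of a chain in the even and in the
odd columns: its boundary is `(b z + t w, g ν a z - b' w)` in the periodic bicomplex, and
`(b z + a w, ν a z - b w)` in the Tate bicomplex of `ℤ/p`. The map `(y, v) ↦ (y, g v)` from the Tate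
bicomplex to the periodic one has the homotopy section `(z, w) ↦ (x, K x)` with `x = z + t s w` and
`K = t s g ν`, and the homotopy is `(z, w) ↦ (0, s w)`. The section exists because the norm of `σ`
is null-homotopic on the standard complex: it equals `b K + K b`. -/
theorem periodic_exact_of_tate_exact (b b' t g s a ν : Module.End k M)
    (hbt : b * t = t * b') (hb'g : b' * g = g * b) (hs : b' * s + s * b' = 1)
    (htg : t * g = a) (hgt : g * t = a) (has : Commute a s)
    (hνb : Commute ν b) (hνs : Commute ν s) (hνt : Commute ν t) (hνg : Commute ν g)
    (hνaa : ν * a * a = 0)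
    (htate : ∀ z w, b z + a w = 0 → ν (a z) - b w = 0 →
      ∃ y v, b y + a v = z ∧ ν (a y) - b v = w)
    (z w : M) (hz : b z + t w = 0) (hw : g (ν (a z)) - b' w = 0) :
    ∃ y v, b y + t v = z ∧ g (ν (a y)) - b' v = w := by
  have bt x : b (t x) = t (b' x) := LinearMap.congr_fun hbt x
  have b'g x : b' (g x) = g (b x) := LinearMap.congr_fun hb'g x
  have b's x : b' (s x) = x - s (b' x) := eq_sub_of_add_eq (LinearMap.congr_fun hs x)
  have tg x : t (g x) = a x := LinearMap.congr_fun htg x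
  have gt x : g (t x) = a x := LinearMap.congr_fun hgt x
  have ta x : t (a x) = a (t x) := by rw [← gt, tg]
  have ga x : g (a x) = a (g x) := by rw [← tg, gt]
  have sa x : s (a x) = a (s x) := (LinearMap.congr_fun has.eq x).symm
  have bν x : b (ν x) = ν (b x) := (LinearMap.congr_fun hνb.eq x).symm
  have sν x : s (ν x) = ν (s x) := (LinearMap.congr_fun hνs.eq x).symm
  have tν x : t (ν x) = ν (t x) := (LinearMap.congr_fun hνt.eq x).symm
  have gν x : g (ν x) = ν (g x) := (LinearMap.congr_fun hνg.eq x).symm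
  have aν x : a (ν x) = ν (a x) := by rw [← tg, gν, tν, tg]
  have νaa x : ν (a (a x)) = 0 := LinearMap.congr_fun hνaa x
  have hw' : b' w = ν (a (g z)) := by rw [sub_eq_zero] at hw; rw [← hw, gν, ga]
  obtain ⟨x, hx⟩ : ∃ x, x = z + t (s w) := ⟨_, rfl⟩
  have hbx : b x = -ν (a (t (s (g z)))) := by
    rw [hx, map_add, bt, b's, hw', eq_neg_of_add_eq_zero_left hz]
    simp only [map_sub, sν, sa, tν, ta]
    abel
  obtain ⟨y, v, hy, hv⟩ := htate x (ν (t (s (g x)))) (by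
      rw [hbx, aν, hx]; simp only [map_add, gt, sa, ta, νaa, add_zero, neg_add_cancel]) (by
      rw [bν, bt, b's, b'g, hbx]
      simp only [map_sub, map_neg, tg, gt, gν, ga, νaa, map_zero]
      abel)
  -- The image `(y, g v)` of the Tate chain has boundary `(x, g K x)`; the homotopy corrects it by
  -- `(0, -s w)`.
  refine ⟨y, g v - s w, ?_, ?_⟩
  · rw [map_sub, tg, ← add_sub_assoc, hy, hx, add_sub_cancel_right]
  · rw [map_sub, b'g, b's, hw', eq_add_of_sub_eq hv, map_add]
    simp only [gν, gt, sν, sa, hx, map_add, νaa, add_zero]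
    abel

end Comparison

/-! ### Exactness of a Tate bicomplex -/

section Sequences

variable {k : Type*} [Field k] {V : ℕ → Type*} [∀ n, AddCommGroup (V n)] [∀ n, Module k (V n)]

/-- The endomorphism of `∏ V n` acting on each factor by a given endomorphism. -/
def diag : (∀ n, Module.End k (V n)) →+* Module.End k (∀ n, V n) where
  toFun f := LinearMap.pi fun n => f n ∘ₗ LinearMap.proj n
  map_one' := rfl
  map_mul' _ _ := rfl
  map_zero' := rfl
  map_add' _ _ := rfl

/-- The endomorphism `x ↦ (f n (x (n + 1)))ₙ` of `∏ V n`, lowering the row by one. -/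
def lower (f : ∀ n, V (n + 1) →ₗ[k] V n) : Module.End k (∀ n, V n) :=
  LinearMap.pi fun n => f n ∘ₗ LinearMap.proj (n + 1)

/-- The endomorphism of `∏ V n` raising the row by one; the entry of its values in row `0` is `0`. -/
def raise (f : ∀ n, V n →ₗ[k] V (n + 1)) : Module.End k (∀ n, V n) :=
  LinearMap.pi fun
    | 0 => 0
    | n + 1 => f n ∘ₗ LinearMap.proj n

@[simp] theorem diag_apply (f : ∀ n, Module.End k (V n)) (x : ∀ n, V n) (n : ℕ) :
    diag f x n = f n (x n) := rfl

@[simp] theorem lower_apply (f : ∀ n, V (n + 1) →ₗ[k] V n) (x : ∀ n, V n) (n : ℕ) :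
    lower f x n = f n (x (n + 1)) := rfl

@[simp] theorem raise_zero (f : ∀ n, V n →ₗ[k] V (n + 1)) (x : ∀ n, V n) :
    raise f x 0 = 0 := rfl

@[simp] theorem raise_succ (f : ∀ n, V n →ₗ[k] V (n + 1)) (x : ∀ n, V n) (n : ℕ) :
    raise f x (n + 1) = f n (x n) := rfl

theorem diag_commute_lower {f : ∀ n, Module.End k (V n)} {c : ∀ n, V (n + 1) →ₗ[k] V n}
    (h : ∀ n x, f n (c n x) = c n (f (n + 1) x)) : Commute (diag f) (lower c) :=
  LinearMap.ext fun x => funext fun n => h n (x (n + 1))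

theorem diag_commute_raise {f : ∀ n, Module.End k (V n)} {c : ∀ n, V n →ₗ[k] V (n + 1)}
    (h : ∀ n x, f (n + 1) (c n x) = c n (f n x)) : Commute (diag f) (raise c) := by
  refine LinearMap.ext fun x => funext fun n => ?_
  cases n with
  | zero => simp
  | succ n => exact h n (x n)

variable {b : ∀ n, V (n + 1) →ₗ[k] V n} {a N : ∀ n, Module.End k (V n)}

/-- A cycle of the Tate bicomplex with finitely many nonzero rows is a boundary as soon as the rows
are exact: its top row is a horizontal boundary, and subtracting the total boundary leaves a shorter
cycle. -/
theorem tate_exact_of_finite (hbb : lower b * lower b = 0) (haN : diag a * diag N = 0)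
    (hNa : diag N * diag a = 0) (hab : Commute (diag a) (lower b))
    (hNb : Commute (diag N) (lower b)) (hker_a : ∀ n x, a n x = 0 → ∃ y, N n y = x)
    (hker_N : ∀ n x, N n x = 0 → ∃ y, a n y = x) (m : ℕ) (z w : ∀ n, V n)
    (hz : lower b z + diag a w = 0) (hw : diag N z - lower b w = 0)
    (hzm : ∀ n, m ≤ n → z n = 0) (hwm : ∀ n, m ≤ n → w n = 0) :
    ∃ y v, lower b y + diag a v = z ∧ diag N y - lower b v = w := by
  induction m generalizing z w with
  | zero =>
    obtain rfl : z = 0 := funext fun n => hzm n n.zero_le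
    obtain rfl : w = 0 := funext fun n => hwm n n.zero_le
    exact ⟨0, 0, by simp, by simp⟩
  | succ m ih =>
    have bb x : lower b (lower b x) = 0 := LinearMap.congr_fun hbb x
    have aN x : diag a (diag N x) = 0 := LinearMap.congr_fun haN x
    have Na x : diag N (diag a x) = 0 := LinearMap.congr_fun hNa x
    have ab x : diag a (lower b x) = lower b (diag a x) := LinearMap.congr_fun hab x
    have Nb x : diag N (lower b x) = lower b (diag N x) := LinearMap.congr_fun hNb x
    obtain ⟨v, hv⟩ := hker_N m (z m) (by
      have := congrFun hw m
      simpa [hwm (m + 1) le_rfl] using this)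
    obtain ⟨y, hy⟩ := hker_a m (w m) (by
      have := congrFun hz m
      simpa [hzm (m + 1) le_rfl] using this)
    have hne n (hn : m ≤ n) : n + 1 ≠ m := by omega
    obtain ⟨y', v', hy', hv'⟩ := ih
      (z - (lower b (Pi.single m y) + diag a (Pi.single m v)))
      (w - (diag N (Pi.single m y) - lower b (Pi.single m v)))
      (by refine Eq.trans ?_ hz; simp only [map_sub, map_add, bb, aN, ab]; abel)
      (by refine Eq.trans ?_ hw; simp only [map_sub, map_add, bb, Na, Nb]; abel)
      (fun n hn => by
        rcases hn.eq_or_lt with rfl | hn'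
        · simp [hv]
        · simp [hzm n hn', hne n hn, hn'.ne'])
      (fun n hn => by
        rcases hn.eq_or_lt with rfl | hn'
        · simp [hy]
        · simp [hwm n hn', hne n hn, hn'.ne'])
    refine ⟨y' + Pi.single m y, v' + Pi.single m v, ?_, ?_⟩
    · rw [map_add, map_add, add_add_add_comm, hy', sub_add_cancel]
    · rw [map_add, map_add, add_sub_add_comm, hv', sub_add_cancel]

/-- If the columns of the Tate bicomplex are contractible above some row, compatibly with the horizontal
operators, then exactness of the rows makes the product total complex exact: the contraction `h`
replaces a cycle by a homologous one with finitely many nonzero rows. -/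
theorem tate_exact (hbb : lower b * lower b = 0) (haN : diag a * diag N = 0)
    (hNa : diag N * diag a = 0) (hab : Commute (diag a) (lower b))
    (hNb : Commute (diag N) (lower b)) (hker_a : ∀ n x, a n x = 0 → ∃ y, N n y = x)
    (hker_N : ∀ n x, N n x = 0 → ∃ y, a n y = x) {h : Module.End k (∀ n, V n)}
    (hah : Commute (diag a) h) (hNh : Commute (diag N) h) {m : ℕ}
    (hh : ∀ x n, m ≤ n → lower b (h x) n + h (lower b x) n = x n) (z w : ∀ n, V n)
    (hz : lower b z + diag a w = 0) (hw : diag N z - lower b w = 0) :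
    ∃ y v, lower b y + diag a v = z ∧ diag N y - lower b v = w := by
  have bb x : lower b (lower b x) = 0 := LinearMap.congr_fun hbb x
  have aN x : diag a (diag N x) = 0 := LinearMap.congr_fun haN x
  have Na x : diag N (diag a x) = 0 := LinearMap.congr_fun hNa x
  have ab x : diag a (lower b x) = lower b (diag a x) := LinearMap.congr_fun hab x
  have Nb x : diag N (lower b x) = lower b (diag N x) := LinearMap.congr_fun hNb x
  have ah x : diag a (h x) = h (diag a x) := LinearMap.congr_fun hah x
  have Nh x : diag N (h x) = h (diag N x) := LinearMap.congr_fun hNh x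
  obtain ⟨y, v, hy, hv⟩ := tate_exact_of_finite hbb haN hNa hab hNb hker_a hker_N m
    (z - (lower b (h z) - diag a (h w))) (w - (diag N (h z) + lower b (h w)))
    (by refine Eq.trans ?_ hz; simp only [map_sub, map_add, bb, aN, ab]; abel)
    (by refine Eq.trans ?_ hw; simp only [map_sub, map_add, bb, Na, Nb]; abel)
    (fun n hn => by
      rw [ah, eq_neg_of_add_eq_zero_right hz, map_neg, sub_neg_eq_add, Pi.sub_apply, Pi.add_apply,
        hh z n hn, sub_self])
    (fun n hn => by
      rw [Nh, sub_eq_zero.1 hw, add_comm, Pi.sub_apply, Pi.add_apply, hh w n hn, sub_self])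
  refine ⟨y + h z, v - h w, ?_, ?_⟩
  · rw [← sub_eq_zero, ← sub_eq_zero.2 hy, map_add, map_sub]
    abel
  · rw [← sub_eq_zero, ← sub_eq_zero.2 hv, map_add, map_sub]
    abel

end Sequences

/-! ### Tate exactness of free modules -/

/-- The cyclotomic congruence `1 + X + ⋯ + X ^ (p - 1) = (1 - X) ^ (p - 1)` in characteristic `p`,
evaluated in an algebra. -/
theorem geom_sum_eq_one_sub_pow {p : ℕ} [Fact p.Prime] (k : Type*) {R : Type*} [Field k]
    [CharP k p] [Ring R] [Algebra k R] (x : R) :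
    ∑ j ∈ Finset.range p, x ^ j = (1 - x) ^ (p - 1) := by
  have h0 : (1 - Polynomial.X : Polynomial k) ≠ 0 :=
    fun h => by simpa using congrArg (Polynomial.eval 0) h
  have key : ∑ j ∈ Finset.range p, (Polynomial.X : Polynomial k) ^ j =
      (1 - Polynomial.X) ^ (p - 1) := by
    apply mul_left_cancel₀ h0
    rw [mul_neg_geom_sum, ← pow_succ', Nat.sub_add_cancel (Fact.out : p.Prime).one_le,
      sub_pow_char, one_pow]
  simpa using congrArg (Polynomial.aeval x) key

section Free

variable {R M : Type*} [CommRing R] [AddCommGroup M] [Module R M] [Module.Free R M]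

/-- Exactness of multiplication by `u` and `v` on a ring passes to free modules, coordinatewise. -/
theorem exists_smul_eq_of_free {u v : R} (huv : ∀ r, u * r = 0 → ∃ r', v * r' = r) {x : M}
    (hx : u • x = 0) : ∃ y, v • y = x := by
  let B := Module.Free.chooseBasis R M
  have h i : ∃ r', v * r' = B.repr x i := huv _ (by
    rw [← smul_eq_mul, ← Finsupp.smul_apply, ← map_smul, hx, map_zero, Finsupp.zero_apply])
  choose c hc using h
  refine ⟨∑ i ∈ (B.repr x).support, c i • B i, ?_⟩
  rw [Finset.smul_sum]
  simp only [smul_smul, hc]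
  exact B.linearCombination_repr x

end Free

section Cyclic

open Representation

variable {k G V : Type*} [Field k] [CommGroup G] [AddCommGroup V] [Module k V]

theorem leftRegular_apply_eq_mul (g : G) (r : MonoidAlgebra k G) :
    leftRegular k G g r = MonoidAlgebra.of k G g * r := by
  induction r using MonoidAlgebra.induction_linear with
  | zero => simp
  | add x y hx hy => rw [map_add, hx, hy, mul_add]
  | single h c => simp

theorem of_smul_asModule (ρ : Representation k G V) (g : G) (x : V) :
    MonoidAlgebra.of k G g • ρ.asModuleEquiv.symm x = ρ.asModuleEquiv.symm (ρ g x) :=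
  (asModuleEquiv_symm_map_rho ρ g x).symm

theorem sum_of_smul_asModule [Fintype G] (ρ : Representation k G V) (x : V) :
    (∑ g : G, MonoidAlgebra.of k G g) • ρ.asModuleEquiv.symm x =
      ρ.asModuleEquiv.symm (ρ.norm x) := by
  simp only [Finset.sum_smul, of_smul_asModule, Representation.norm, LinearMap.sum_apply, map_sum]

variable [Fintype G] (ρ : Representation k G V) [Module.Free (MonoidAlgebra k G) ρ.asModule]
  {g : G}

/-- For a cyclic group, invariants of a free module are norms. -/
theorem exists_norm_eq_of_free (hg : ∀ x, x ∈ Subgroup.zpowers g) {x : V} (hx : ρ g x = x) :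
    ∃ y, ρ.norm y = x := by
  obtain ⟨y, hy⟩ := exists_smul_eq_of_free (u := MonoidAlgebra.of k G g - 1)
    (v := ∑ h : G, MonoidAlgebra.of k G h) (x := ρ.asModuleEquiv.symm x) (fun r hr => by
      have := coeff_of_leftRegular_of_generator (k := k) g hg r (by
        rwa [leftRegular_apply_eq_mul, ← sub_eq_zero, ← sub_one_mul])
      refine ⟨.single 1 (r.coeff g), ?_⟩
      ext h
      simp [this h, Finset.sum_mul, MonoidAlgebra.single_mul_single, MonoidAlgebra.coeff_sum])
    (by rw [sub_smul, of_smul_asModule, hx, one_smul, sub_self])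
  exact ⟨ρ.asModuleEquiv y, ρ.asModuleEquiv.symm.injective
    ((sum_of_smul_asModule ρ _).symm.trans hy)⟩

/-- For a cyclic group, elements of norm zero of a free module are of the form `g y - y`. -/
theorem exists_sub_eq_of_free (hg : ∀ x, x ∈ Subgroup.zpowers g) {x : V} (hx : ρ.norm x = 0) :
    ∃ y, ρ g y - y = x := by
  obtain ⟨y, hy⟩ := exists_smul_eq_of_free (v := MonoidAlgebra.of k G g - 1)
    (u := ∑ h : G, MonoidAlgebra.of k G h) (x := ρ.asModuleEquiv.symm x) (fun r hr => by
      have h1 : r ∈ LinearMap.ker (leftRegular k G).norm := by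
        rw [LinearMap.mem_ker, Representation.norm, LinearMap.sum_apply, ← hr, Finset.sum_mul]
        simp only [leftRegular_apply_eq_mul]
      rw [ker_leftRegular_norm_eq, ← FiniteCyclicGroup.coinvariantsKer_leftRegular_eq_ker,
        FiniteCyclicGroup.coinvariantsKer_eq_range _ g hg] at h1
      obtain ⟨r', rfl⟩ := h1
      exact ⟨r', by rw [sub_one_mul, ← leftRegular_apply_eq_mul]; rfl⟩)
    (by rw [sum_of_smul_asModule, hx, map_zero])
  refine ⟨ρ.asModuleEquiv y, ρ.asModuleEquiv.symm.injective ?_⟩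
  rw [map_sub, ← of_smul_asModule, ← hy, sub_smul, one_smul]
  rfl

end Cyclic

/-! ### The extra degeneracy -/

namespace LambdaInf

/-- The injection `a * (n + 1) + b ↦ a * (n + 2) + b + 1`, `0 ≤ b ≤ n`, whose image misses the multiples
of `n + 2`. -/
def extraFun (n : ℕ) (x : ℤ) : ℤ := x + x / ((n : ℤ) + 1) + 1

theorem extraFun_rep (n : ℕ) (a b : ℤ) (h0 : 0 ≤ b) (h1 : b ≤ n) :
    extraFun n (a * ((n : ℤ) + 1) + b) = a * (((n + 1 : ℕ) : ℤ) + 1) + (b + 1) := by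
  have hd : (a * ((n : ℤ) + 1) + b) / ((n : ℤ) + 1) = a := by
    rw [add_comm, Int.add_mul_ediv_right _ _ (by omega), Int.ediv_eq_zero_of_lt h0 (by omega),
      zero_add]
  rw [extraFun, hd]
  push_cast
  ring

/-- The map `[n + 1] ⟶ [n + 2]` given by `extraFun`, the extra degeneracy. -/
def extra (n : ℕ) : ob n ⟶ ob (n + 1) :=
  (⟨extraFun n, fun x y h => by
    have := Int.ediv_le_ediv (show (0 : ℤ) < (n : ℤ) + 1 by omega) h
    unfold extraFun
    omega, fun x => by
    simp only [ob_len, extraFun]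
    rw [Int.add_ediv_of_dvd_right (dvd_refl _), Int.ediv_self (by omega)]
    push_cast
    ring⟩ : Hom (ob n) (ob (n + 1)))

@[simp] theorem extra_toFun (n : ℕ) (x : ℤ) : Hom.toFun (extra n) x = extraFun n x := rfl

theorem extra_face_zero (n : ℕ) : extra n ≫ face n 0 = 𝟙 (ob n) := by
  refine hom_ext fun x => ?_
  obtain ⟨a, b, h0, h1, rfl⟩ := exists_rep n x
  rw [comp_toFun, extra_toFun, face_toFun, extraFun_rep n a b h0 h1,
    faceFun_lt _ _ _ _ (by omega) (by push_cast; omega), if_neg (by push_cast; omega), id_toFun]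
  push_cast
  ring

theorem extra_face_succ (n i : ℕ) (hi : i ≤ n) :
    extra (n + 1) ≫ face (n + 1) (i + 1) = face n i ≫ extra n := by
  refine hom_ext fun x => ?_
  obtain ⟨a, b, h0, h1, rfl⟩ := exists_rep (n + 1) x
  simp only [comp_toFun, extra_toFun, face_toFun]
  rw [extraFun_rep _ a b h0 h1, faceFun_lt _ _ _ _ (by omega) (by push_cast at h1 ⊢; omega),
    faceFun_lt _ _ _ _ h0 h1, show ((n + 1 : ℕ) : ℤ) = (n : ℤ) + 1 by push_cast; rfl,
    extraFun_rep n a _ (by split_ifs <;> omega) (by push_cast at h1; split_ifs <;> omega)]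
  push_cast
  split_ifs <;> omega

end LambdaInf

noncomputable section

variable {p : ℕ} {k : Type u} [Field k] (E : PCyclicObject.{u, w} p k)

/-- The action of the extra degeneracy on `E`, which contracts the complex with differential `b'`. -/
def extraDeg (n : ℕ) : E.obj (ob p n) →ₗ[k] E.obj (ob p (n + 1)) := act E (LambdaInf.extra n)

theorem signedFace_zero_extraDeg (n : ℕ) : signedFace E n 0 ∘ₗ extraDeg E n = 1 := by
  rw [signedFace, pow_zero, one_smul, extraDeg, ← act_comp, LambdaInf.extra_face_zero, act_id]

theorem signedFace_succ_extraDeg (n i : ℕ) (hi : i ≤ n) :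
    signedFace E (n + 1) (i + 1) ∘ₗ extraDeg E (n + 1) = -(extraDeg E n ∘ₗ signedFace E n i) := by
  rw [signedFace, signedFace, extraDeg, extraDeg, LinearMap.smul_comp, LinearMap.comp_smul,
    ← act_comp, ← act_comp, LambdaInf.extra_face_succ n i hi, pow_succ, mul_neg_one, neg_smul]

theorem b'_extraDeg_zero : b' E 0 ∘ₗ extraDeg E 0 = 1 := by
  rw [b', Finset.sum_range_one, signedFace_zero_extraDeg]

theorem b'_extraDeg_succ (n : ℕ) :
    b' E (n + 1) ∘ₗ extraDeg E (n + 1) + extraDeg E n ∘ₗ b' E n = 1 := by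
  rw [b', b', Finset.sum_range_succ', LinearMap.add_comp, signedFace_zero_extraDeg, lin_sum_comp,
    lin_comp_sum, Finset.sum_congr rfl fun i hi =>
      signedFace_succ_extraDeg E n i (Nat.lt_succ_iff.1 (Finset.mem_range.1 hi)),
    Finset.sum_neg_distrib]
  abel

/-! ### Smallness in terms of linear maps -/

theorem rho_one [Fact p.Prime] (X : LambdaInf) :
    rho E X (Multiplicative.ofAdd 1) = sigma E X := by
  have : Fact (1 < p) := ⟨(Fact.out : p.Prime).one_lt⟩
  change sigma E X ^ (1 : ZMod p).val = _
  rw [ZMod.val_one, pow_one]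

theorem standardComplex_d [NeZero p] (n : ℕ) : (standardComplex E).d (n + 1) n = bRep E n :=
  ChainComplex.of_d (fun n => Rep.of (rho E (LambdaInf.ob n))) (bRep E) n

/-- Smallness makes the standard complex contractible in high degrees, `ℤ/p`-equivariantly: the
complex of finite length, through which the identity factors up to homotopy, vanishes there. -/
theorem IsSmall.exists_contraction [Fact p.Prime] {E : PCyclicObject.{u, w} p k}
    (h : IsSmall E) :
    ∃ (m : ℕ) (c : ∀ n, E.obj (ob p n) →ₗ[k] E.obj (ob p (n + 1))),
      (∀ n, c n ∘ₗ sigma E _ = sigma E _ ∘ₗ c n) ∧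
      ∀ n, m ≤ n → b E (n + 1) ∘ₗ c (n + 1) + c n ∘ₗ b E n = 1 := by
  obtain ⟨D, m, hD, ⟨f⟩⟩ := h
  let c (n : ℕ) : Rep.of (rho E (LambdaInf.ob n)) ⟶ Rep.of (rho E (LambdaInf.ob (n + 1))) :=
    f.homotopyHomInvId.hom n (n + 1)
  refine ⟨m, fun n => -(c n).hom.toLinearMap, fun n => ?_, fun n hn => ?_⟩
  · have := (c n).hom.isIntertwining' (Multiplicative.ofAdd 1)
    simp only [rho_one] at this
    rw [LinearMap.neg_comp, LinearMap.comp_neg]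
    exact congrArg _ this
  · have h1 := f.homotopyHomInvId.comm (n + 1)
    rw [HomologicalComplex.comp_f, (hD (n + 1) (by omega)).eq_of_tgt (f.hom.f (n + 1)) 0,
      Limits.zero_comp, Homotopy.dNext_succ_chainComplex, Homotopy.prevD_chainComplex,
      standardComplex_d, standardComplex_d] at h1
    have h2 : (0 : Module.End k (E.obj (ob p (n + 1)))) =
        (c n).hom.toLinearMap ∘ₗ b E n + b E (n + 1) ∘ₗ (c (n + 1)).hom.toLinearMap + 1 :=
      congrArg (fun q : Rep.of (rho E (LambdaInf.ob (n + 1))) ⟶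
        Rep.of (rho E (LambdaInf.ob (n + 1))) => q.hom.toLinearMap) h1
    rw [LinearMap.neg_comp, LinearMap.comp_neg, ← neg_add]
    rw [add_comm (_ ∘ₗ b E n)] at h2
    exact neg_eq_of_add_eq_zero_right h2.symm

/-! ### Vanishing of periodic cyclic homology -/

/-- The family of the operators `σ` on all `E([n + 1])`. -/
def sigmaSeq : ∀ n, Module.End k (E.obj (ob p n)) := fun n => sigma E (LambdaInf.ob n)

/-- The family of the operators `1 + τ + ⋯ + τ ^ n` on all `E([n + 1])`. -/
def partialNorm : ∀ n, Module.End k (E.obj (ob p n)) :=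
  fun n => ∑ j ∈ Finset.range (n + 1), tau E n ^ j

theorem one_sub_tau_mul_partialNorm : (1 - tau E) * partialNorm E = 1 - sigmaSeq E :=
  funext fun n => by
    change (1 - tau E n) * ∑ j ∈ Finset.range (n + 1), tau E n ^ j = 1 - sigma E (LambdaInf.ob n)
    rw [mul_neg_geom_sum, tau_pow]

theorem partialNorm_mul_one_sub_tau : partialNorm E * (1 - tau E) = 1 - sigmaSeq E :=
  funext fun n => by
    change (∑ j ∈ Finset.range (n + 1), tau E n ^ j) * (1 - tau E n) = 1 - sigma E (LambdaInf.ob n)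
    rw [geom_sum_mul_neg, tau_pow]

theorem b'_partialNorm (n : ℕ) :
    b' E n ∘ₗ partialNorm E (n + 1) = partialNorm E n ∘ₗ b E n :=
  sum_comp_geom (n + 1) _ _ _ (fun i hi => signedFace_tau_succ E n i hi) (signedFace_tau_zero E n)

theorem sigma_tau : Commute (sigmaSeq E) (tau E) :=
  funext fun n => by
    change sigma E (LambdaInf.ob n) * tau E n = tau E n * sigma E (LambdaInf.ob n)
    rw [← tau_pow, ← pow_succ, ← pow_succ']

theorem one_sub_sigma_pow_char [Fact p.Prime] [CharP k p] : (1 - sigmaSeq E) ^ p = 0 :=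
  funext fun n => by
    change (1 - sigma E (LambdaInf.ob n)) ^ p = 0
    rw [← pow_sub_one_mul (Fact.out : p.Prime).ne_zero, ← geom_sum_eq_one_sub_pow k,
      geom_sum_mul_neg, sigma_pow, sub_self]

theorem normTau_eq [Fact p.Prime] [CharP k p] :
    normTau E = partialNorm E * (1 - sigmaSeq E) ^ (p - 1) :=
  funext fun n => by
    rw [normTau, geom_mul, tau_pow, geom_sum_eq_one_sub_pow k]
    rfl

theorem rho_norm [Fact p.Prime] [CharP k p] (X : LambdaInf) :
    (rho E X).norm = (1 - sigma E X) ^ (p - 1) := by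
  rw [← geom_sum_eq_one_sub_pow k, Representation.norm]
  refine Finset.sum_nbij (fun g => (Multiplicative.toAdd g).val)
    (fun g _ => Finset.mem_range.2 (ZMod.val_lt _)) (fun g _ h _ e => ZMod.val_injective p e)
    (fun j hj => ⟨Multiplicative.ofAdd (j : ZMod p), by simp, ?_⟩) (fun g _ => rfl)
  exact ZMod.val_cast_of_lt (Finset.mem_range.1 hj)

theorem mem_zpowers_ofAdd_one (x : Multiplicative (ZMod p)) :
    x ∈ Subgroup.zpowers (Multiplicative.ofAdd (1 : ZMod p)) := by
  obtain ⟨j, hj⟩ := ZMod.intCast_surjective (Multiplicative.toAdd x)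
  exact ⟨j, Multiplicative.toAdd.injective (by simpa using hj)⟩

theorem one_sub_sigma_exact [Fact p.Prime] [CharP k p] (hE : IsTermwiseFree E) (X : LambdaInf)
    (x : E.obj ((proj p).obj X)) (hx : (1 - sigma E X) x = 0) :
    ∃ y, ((1 - sigma E X) ^ (p - 1)) y = x := by
  have := hE X
  rw [← rho_norm]
  refine exists_norm_eq_of_free (rho E X) mem_zpowers_ofAdd_one ?_
  rw [rho_one]
  exact (sub_eq_zero.1 hx).symm

theorem norm_sigma_exact [Fact p.Prime] [CharP k p] (hE : IsTermwiseFree E) (X : LambdaInf)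
    (x : E.obj ((proj p).obj X)) (hx : ((1 - sigma E X) ^ (p - 1)) x = 0) :
    ∃ y, (1 - sigma E X) y = x := by
  have := hE X
  rw [← rho_norm] at hx
  obtain ⟨y, hy⟩ := exists_sub_eq_of_free (rho E X) mem_zpowers_ofAdd_one hx
  rw [rho_one] at hy
  exact ⟨-y, by rw [← hy, map_neg]; exact neg_sub _ _⟩

theorem sigma_commute_lower {c : ∀ n, E.obj (ob p (n + 1)) →ₗ[k] E.obj (ob p n)}
    (h : ∀ n, c n ∘ₗ sigma E _ = sigma E _ ∘ₗ c n) : Commute (diag (sigmaSeq E)) (lower c) :=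
  diag_commute_lower fun n x => (LinearMap.congr_fun (h n) x).symm

theorem sigma_commute_raise {c : ∀ n, E.obj (ob p n) →ₗ[k] E.obj (ob p (n + 1))}
    (h : ∀ n, c n ∘ₗ sigma E _ = sigma E _ ∘ₗ c n) : Commute (diag (sigmaSeq E)) (raise c) :=
  diag_commute_raise fun n x => (LinearMap.congr_fun (h n) x).symm

theorem b'_raise_extraDeg :
    lower (b' E) * raise (extraDeg E) + raise (extraDeg E) * lower (b' E) = 1 := by
  refine LinearMap.ext fun x => funext fun n => ?_
  cases n with
  | zero => simpa using LinearMap.congr_fun (b'_extraDeg_zero E) (x 0)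
  | succ n => exact LinearMap.congr_fun (b'_extraDeg_succ E n) (x (n + 1))

theorem one_sub_sigma_commute {c : Module.End k (∀ n, E.obj (ob p n))}
    (h : Commute (diag (sigmaSeq E)) c) (j : ℕ) : Commute (diag ((1 - sigmaSeq E) ^ j)) c := by
  rw [map_pow, map_sub, map_one]
  exact ((Commute.one_left _).sub_left h).pow_left j

/-- The product Tate bicomplex of `ℤ/p` with coefficients in the standard complex is exact. The
components of a chain in even and in odd columns are `z` and `w`. -/
theorem tate_exact_of_isSmall [Fact p.Prime] [CharP k p] (hsmall : IsSmall E)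
    (hfree : IsTermwiseFree E) (z w : ∀ n, E.obj (ob p n))
    (hz : lower (b E) z + diag (1 - sigmaSeq E) w = 0)
    (hw : diag ((1 - sigmaSeq E) ^ (p - 1)) z - lower (b E) w = 0) :
    ∃ y v, lower (b E) y + diag (1 - sigmaSeq E) v = z ∧
      diag ((1 - sigmaSeq E) ^ (p - 1)) y - lower (b E) v = w := by
  obtain ⟨m, c, hc, hbc⟩ := hsmall.exists_contraction
  have h0 := one_sub_sigma_pow_char E
  have hp : p - 1 + 1 = p := Nat.sub_add_cancel (Fact.out : p.Prime).one_le
  have hb := sigma_commute_lower E fun n => by simpa using sigma_b E n 1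
  have hcs := sigma_commute_raise E hc
  refine tate_exact (b := b E) (a := 1 - sigmaSeq E)
    (N := (1 - sigmaSeq E) ^ (p - 1)) (h := raise c) (m := m + 1)
    (LinearMap.ext fun x => funext fun n => LinearMap.congr_fun (b_b E n) (x (n + 2)))
    (by rw [← map_mul, ← pow_succ', hp, h0, map_zero])
    (by rw [← map_mul, ← pow_succ, hp, h0, map_zero])
    (by simpa using one_sub_sigma_commute E hb 1) (one_sub_sigma_commute E hb _)
    (fun n => one_sub_sigma_exact E hfree (LambdaInf.ob n))
    (fun n => norm_sigma_exact E hfree (LambdaInf.ob n))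
    (by simpa using one_sub_sigma_commute E hcs 1) (one_sub_sigma_commute E hcs _)
    (fun x n hn => ?_) z w hz hw
  obtain ⟨n, rfl⟩ : ∃ l, n = l + 1 := ⟨n - 1, by omega⟩
  exact LinearMap.congr_fun (hbc n (by omega)) (x (n + 1))

/-- The periodic bicomplex is exact, with chains written as pairs of an even part `z` and an odd part
`w`. No parity condition is put on the rows of `z` and `w`, so this is exactness of the sum of two
consecutive degrees. -/
theorem periodic_exact [Fact p.Prime] [CharP k p] (hsmall : IsSmall E)
    (hfree : IsTermwiseFree E) (z w : ∀ n, E.obj (ob p n))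
    (hz : lower (b E) z + diag (1 - tau E) w = 0)
    (hw : diag (normTau E) z - lower (b' E) w = 0) :
    ∃ y v, lower (b E) y + diag (1 - tau E) v = z ∧
      diag (normTau E) y - lower (b' E) v = w := by
  have hp : 2 ≤ p := (Fact.out : p.Prime).two_le
  have h0 := one_sub_sigma_pow_char E
  have hb := sigma_commute_lower E fun n => by simpa using sigma_b E n 1
  have hs := sigma_commute_raise E (c := extraDeg E) fun n => sigma_comm E _
  have ht : Commute (diag (sigmaSeq E)) (diag (1 - tau E)) :=
    ((Commute.one_right _).sub_right (sigma_tau E)).map diag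
  have hg : Commute (diag (sigmaSeq E)) (diag (partialNorm E)) := by
    have : Commute (sigmaSeq E) (partialNorm E) := funext fun n =>
      Commute.sum_right _ _ _ fun j _ => (show Commute (sigmaSeq E n) (tau E n) from
        congrFun (sigma_tau E) n).pow_right j
    exact this.map diag
  have hνa : (1 - sigmaSeq E) ^ (p - 1) = (1 - sigmaSeq E) ^ (p - 2) * (1 - sigmaSeq E) := by
    rw [← pow_succ]
    congr 1
    omega
  have key := periodic_exact_of_tate_exact (lower (b E)) (lower (b' E)) (diag (1 - tau E))
    (diag (partialNorm E)) (raise (extraDeg E)) (diag (1 - sigmaSeq E))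
    (diag ((1 - sigmaSeq E) ^ (p - 2)))
    (LinearMap.ext fun x => funext fun n => LinearMap.congr_fun (b_one_sub_tau E n) (x (n + 1)))
    (LinearMap.ext fun x => funext fun n => LinearMap.congr_fun (b'_partialNorm E n) (x (n + 1)))
    (b'_raise_extraDeg E)
    (by rw [← map_mul, one_sub_tau_mul_partialNorm])
    (by rw [← map_mul, partialNorm_mul_one_sub_tau])
    (by simpa using one_sub_sigma_commute E hs 1)
    (one_sub_sigma_commute E hb _) (one_sub_sigma_commute E hs _)
    (one_sub_sigma_commute E ht _) (one_sub_sigma_commute E hg _)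
    (by rw [← map_mul, ← map_mul, ← pow_succ, ← pow_succ, show p - 2 + 1 + 1 = p by omega, h0,
      map_zero])
    (fun z w hz hw => by
      have := tate_exact_of_isSmall E hsmall hfree z w hz
      rw [hνa, map_mul] at this
      exact this hw) z w hz
  rw [normTau_eq, hνa, map_mul, map_mul] at hw ⊢
  exact key hw

theorem totalD_exact [Fact p.Prime] [CharP k p] (hsmall : IsSmall E) (hfree : IsTermwiseFree E)
    (d : ℤ) (x : ∀ n, E.obj (ob p n)) (hx : totalD E d x = 0) :
    ∃ y, totalD E (d + 1) y = x := by
  have hpar (n : ℕ) : Even (d - (n + 1 : ℤ)) ↔ ¬ Even (d - n) := by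
    rw [← Int.even_sub_one]
    ring_nf
  have hpar' (n : ℕ) : Even (d + 1 - n) ↔ ¬ Even (d - n) := by
    rw [← Int.even_add_one]
    ring_nf
  have hpar'' (n : ℕ) : Even (d - 1 - n) ↔ ¬ Even (d - n) := by
    rw [← Int.even_sub_one]
    ring_nf
  have hx' (n : ℕ) : horiz E (d - n) n (x n) + vert E (d - 1 - n) n (x (n + 1)) = 0 := congrFun hx n
  obtain ⟨y, v, hy, hv⟩ := periodic_exact E hsmall hfree
    (fun n => if Even (d - n) then x n else 0) (fun n => if Even (d - n) then 0 else x n)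
    (funext fun n => by
      have := hx' n
      by_cases h : Even (d - n)
      · simp [hpar, h]
      · simpa [horiz, vert, hpar, hpar'', h, add_comm] using this)
    (funext fun n => by
      have := hx' n
      by_cases h : Even (d - n)
      · simpa [horiz, vert, hpar, hpar'', h, ← sub_eq_add_neg] using this
      · simp [hpar, h])
  -- In degree `d + 1` the entry of row `n` lies in an even column exactly when `d - n` is odd.
  refine ⟨fun n => if Even (d - n) then v n else y n, funext fun n => ?_⟩
  have hy' := congrFun hy n
  have hv' := congrFun hv n
  change horiz E (d + 1 - n) n _ + vert E (d + 1 - 1 - n) n _ = x n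
  rw [add_sub_cancel_right]
  by_cases h : Even (d - n)
  · simpa [horiz, vert, hpar, hpar', h, add_comm] using hy'
  · simpa [horiz, vert, hpar, hpar', h, ← sub_eq_add_neg] using hv'

end
end PCyclic

theorem mainTheorem6 {p : ℕ} [Fact p.Prime] {k : Type u} [Field k] [CharP k p]
    (E : PCyclic.PCyclicObject.{u, w} p k) (hsmall : PCyclic.IsSmall E)
    (hfree : PCyclic.IsTermwiseFree E) (d : ℤ) :
    Limits.IsZero (PCyclic.HP E d) := by
  rw [PCyclic.HP, ← HomologicalComplex.exactAt_iff_isZero_homology,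
    HomologicalComplex.exactAt_iff' _ (d + 1) d (d - 1) (by simp) (by simp),
    ShortComplex.moduleCat_exact_iff]
  intro x hx
  have hx' : PCyclic.totalD E d x = 0 := by
    change (if d - 1 + 1 = d then ModuleCat.ofHom (PCyclic.totalD E d) else 0).hom x = 0 at hx
    rwa [if_pos (by ring)] at hx
  obtain ⟨y, hy⟩ := PCyclic.totalD_exact E hsmall hfree d x hx'
  refine ⟨y, ?_⟩
  change (if d + 1 = d + 1 then ModuleCat.ofHom (PCyclic.totalD E (d + 1)) else 0).hom y = x
  rwa [if_pos rfl]
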